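/- **Theorem 5.3.** Let $n\ge 2$. A *web graph* $G$ for $\mathfrak{sl}_n$ is a finite directed plane graph (up to planar isotopy relative to the boundary) drawn below a horizontal axis, with univalent boundary vertices on the axis and trivalent interior vertices. It need not be connected, and circle components without vertices are allowed. Its edges have weights in $\{1,\dots,n-1\}$, and at every interior vertex the sum of the weights of the incoming edges minus the sum of the weights of the outgoing edges is $0$ modulo $n$. A *stranding* of $G$ is a collection of directed paths in $G$ (which may run against edges), called *strands*, each colored by one of $1,\dots,n-1$ and each either closed or with both endpoints on the boundary, such that distinct strands of the same color are disjoint. For an edge $e$ let $S(e)$ be the set of colors on $e$, and let $\alpha_c(e)=1$, $-1$ or $0$ according as a strand of color $c$ runs along $e$ in the direction of $e$, against it, or not at all. The stranding is *valid* if for every edge $e$, of weight $\ell$: (1) $\alpha_c(e)\alpha_{c'}(e)=-1$ for any two consecutive elements $c<c'$ of $S(e)$; (2) $S(e)\neq\emptyset$, and for $c_{\max}=\max S(e)$, $\sum_{c=1}^{n-1} c\,\alpha_c(e)=\ell$ if $\alpha_{c_{\max}}(e)=1$ and $\sum_{c=1}^{n-1} c\,\alpha_c(e)=\ell-n$ if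 $\alpha_{c_{\max}}(e)=-1$. The *faces* of $G$ are the connected components of the complement of $G$ in the lower half-plane, and $U$ is the unbounded face (the one at the far left and far right of the axis). In the planar dual $G^*$, whose vertices are the faces, the edge $e^*$ dual to $e$ crosses $e$ from its left to its right and has the weight of $e$. For faces $A,B$ and a path $P$ from $A$ to $B$ in the underlying undirected graph of $G^*$, let $dist_n(A,B,P)\in\{0,\dots,n-1\}$ be the residue modulo $n$ of the sum of the weights of the edges of $P$, where a weight is added if $P$ follows the direction of $e^*$ and subtracted otherwise. Then $dist_n(A,B)=dist_n(A,B,P)$ does not depend on $P$. Define the *base stranding* $S_0^G$ as follows: for each face $A$ with $c=dist_n(U,A)\ne0$, insert strands of color $c$ along the whole boundary of $A$, directed clockwise around $A$ in the sense that $A$ lies on their right (one closed strand for each component of the boundary of $A$), and erase the portions that lie on the axis; faces with $dist_n(U,A)=0$ contribute nothing. Then $S_0^G$ is a stranding of $G$, and it is valid. In particular every web graph has a valid stranding. -/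

import Mathlib

/-!
# Plane webs with boundary, strandings, and the base stranding

A web is drawn in the closed lower half-plane with its boundary vertices on the horizontal axis
and is considered up to planar isotopy relative to the boundary.  Up to isotopy a plane drawing
is a combinatorial map: the cyclic order of the edge ends around every vertex, together with the
faces and the face lying on each side of each edge.  Webs need not be connected, may have no
boundary vertices, and may have components that are circles without vertices.
-/

/-- A finite directed graph (loops and parallel edges allowed) with `bd` boundary vertices
`Sum.inl 0, Sum.inl 1, …`, numbered from left to right, and a finite set `V` of other vertices. -/
structure BoundaryGraph where
  bd : ℕ
  V : Type
  E : Type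
  [fintypeV : Fintype V]
  [decEqV : DecidableEq V]
  [fintypeE : Fintype E]
  [decEqE : DecidableEq E]
  src : E → Fin bd ⊕ V
  tgt : E → Fin bd ⊕ V

attribute [instance] BoundaryGraph.fintypeV BoundaryGraph.decEqV
  BoundaryGraph.fintypeE BoundaryGraph.decEqE

namespace BoundaryGraph

variable (G : BoundaryGraph)

abbrev Vertex : Type := Fin G.bd ⊕ G.V

/-- A dart is an edge together with a direction of travel: `(e, true)` runs along the edge `e`
in its own direction, `(e, false)` runs against it.  The darts with tail `v` are exactly the
edge ends at `v`. -/
abbrev Dart : Type := G.E × Bool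

variable {G}

def rev (d : G.Dart) : G.Dart := (d.1, !d.2)

def tail (d : G.Dart) : G.Vertex := if d.2 then G.src d.1 else G.tgt d.1

def head (d : G.Dart) : G.Vertex := tail (rev d)

def IsBoundary (v : G.Vertex) : Prop := ∃ i : Fin G.bd, v = Sum.inl i

/-- Collapse the boundary axis together with the upper half-plane to one point `none`. -/
def collapse : G.Vertex → Option G.V
  | Sum.inl _ => none
  | Sum.inr v => some v

/-- The number of connected components of the graph in which the boundary axis has been collapsed
to one point (this point is a component of its own when there are no boundary vertices). -/
noncomputable def numComponents (G : BoundaryGraph) : ℕ :=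
  Nat.card (Quot fun x y : Option G.V =>
    ∃ d : G.Dart, x = collapse (tail d) ∧ y = collapse (head d))

def IsTrivalent (v : G.V) : Prop :=
  Fintype.card {d : G.Dart // tail d = Sum.inr v} = 3

/-- `v` is not a genuine vertex but an auxiliary point on a component that is a circle without
vertices; this circle is the edge `e` from `v` to `v`, and nothing else is attached to `v`. -/
def IsCirclePoint (v : G.V) : Prop :=
  ∃ e : G.E, ∀ d : G.Dart, tail d = Sum.inr v ↔ d.1 = e

end BoundaryGraph

/-- A plane drawing, in the lower half-plane, of a graph with univalent boundary vertices on the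
horizontal axis, up to isotopy: a combinatorial map of genus zero.

Collapsing the axis and the upper half-plane to a point turns the lower half-plane into a sphere
without changing the faces, and the drawing into a drawing on that sphere.
The edge ends around the collapsed point are, counterclockwise, the boundary edges from left to
right.  The last two fields say that the surface described by the data is the sphere: it
is connected and Euler's formula `#vertices - #edges + #faces = 1 + #components` holds.
(Faces are data since, for a disconnected graph, the rotation system alone does not tell in which
face a component lies; a face may have several boundary components.) -/
structure PlaneGraph extends BoundaryGraph where
  /-- the edge end at the `i`-th boundary vertex, leaving that vertex -/
  leg : Fin bd → toBoundaryGraph.Dart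
  tail_eq_inl_iff : ∀ (d : toBoundaryGraph.Dart) (i : Fin bd),
    BoundaryGraph.tail d = Sum.inl i ↔ d = leg i
  /-- the next edge end, in counterclockwise order, around the same vertex -/
  rot : Equiv.Perm toBoundaryGraph.Dart
  rot_sameCycle_iff : ∀ d d' : toBoundaryGraph.Dart, rot.SameCycle d d' ↔
    BoundaryGraph.collapse (BoundaryGraph.tail d) = BoundaryGraph.collapse (BoundaryGraph.tail d')
  rot_leg : ∀ i : Fin bd, rot (leg i) = leg (finRotate bd i)
  /-- the faces, that is, the components of the complement of the graph in the half-plane -/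
  F : Type
  [fintypeF : Fintype F]
  /-- the face immediately to the right of a dart -/
  right : toBoundaryGraph.Dart → F
  /-- Travelling along `d` and turning right as sharply as possible at its head, one keeps the
  same face on the right. -/
  right_next : ∀ d : toBoundaryGraph.Dart, right (rot (BoundaryGraph.rev d)) = right d
  /-- the unbounded face, which touches the axis to the left of the first boundary vertex -/
  outer : F
  right_leg_zero : ∀ i : Fin bd, i.val = 0 → right (leg i) = outer
  /-- Any two faces are joined by a sequence of faces, each step crossing an edge. -/
  faces_connected : ∀ A B : F, Relation.ReflTransGen
    (fun X Y : F => ∃ d : toBoundaryGraph.Dart, X = right (BoundaryGraph.rev d) ∧ Y = right d) A B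
  euler : (Fintype.card V + 1) + Fintype.card F
    = Fintype.card E + (1 + toBoundaryGraph.numComponents)

attribute [instance] PlaneGraph.fintypeF

/-- A (Fontaine) web graph for `sl_n`. -/
structure Web (n : ℕ) extends PlaneGraph where
  trivalent_or_circle : ∀ v : V,
    toBoundaryGraph.IsTrivalent v ∨ toBoundaryGraph.IsCirclePoint v
  weight : E → ℕ
  one_le_weight : ∀ e, 1 ≤ weight e
  weight_lt : ∀ e, weight e < n
  /-- Conservation of flow modulo `n`: each edge end directed into `v` counts with its weight,
  each edge end directed out of `v` with minus its weight. -/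
  conservation : ∀ v : V,
    (∑ d : toBoundaryGraph.Dart with BoundaryGraph.tail d = Sum.inr v,
      (if d.2 then -(weight d.1 : ℤ) else (weight d.1 : ℤ))) ≡ 0 [ZMOD n]

namespace Web

open BoundaryGraph

variable {n : ℕ} (G : Web n)

/-- the face immediately to the left of a dart -/
def left (d : G.Dart) : G.F := G.right (rev d)

/-! ### Distance modulo `n` in the planar dual -/

/-- `G.IsDualPath A P B`: the list `P` describes a path in the planar dual from the face `A` to
the face `B`.  Its steps are given by the darts that are crossed, each from left to right;
so every dual edge may be traversed in either direction. -/
def IsDualPath : G.F → List G.Dart → G.F → Prop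
  | A, [], B => A = B
  | A, d :: P, B => G.left d = A ∧ IsDualPath (G.right d) P B

/-- The dual of the edge `e` is directed so that it crosses `e` from left to right and has the
weight of `e`; a step in its direction counts positively, a step against it negatively. -/
def stepWeight (d : G.Dart) : ℤ :=
  if d.2 then (G.weight d.1 : ℤ) else -(G.weight d.1 : ℤ)

/-- the modulo `n` distance along a dual path, as a number in `{0, …, n - 1}` -/
def distAlong (P : List G.Dart) : ℕ := ((P.map G.stepWeight).sum % (n : ℤ)).toNat

theorem exists_isDualPath (A B : G.F) : ∃ P, G.IsDualPath A P B := by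
  induction G.faces_connected A B using Relation.ReflTransGen.head_induction_on with
  | refl => exact ⟨[], rfl⟩
  | head h _ ih =>
    obtain ⟨d, rfl, rfl⟩ := h
    obtain ⟨P, hP⟩ := ih
    exact ⟨d :: P, rfl, hP⟩

/-- the modulo `n` distance from `A` to `B`, computed along some dual path from `A` to `B` -/
noncomputable def dist (A B : G.F) : ℕ := G.distAlong (G.exists_isDualPath A B).choose

/-! ### Strandings -/

/-- `IsWalk u l v`: the consecutive darts of the list `l` lead from the vertex `u` to `v`. -/
def IsWalk : G.Vertex → List G.Dart → G.Vertex → Prop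
  | u, [], v => u = v
  | u, d :: l, v => tail d = u ∧ IsWalk (head d) l v

/-- A colored directed path: closed (a cyclic sequence of darts) or not (a list of darts). -/
inductive Strand : Type
  | closed (c : ℕ) (γ : Cycle G.Dart) : Strand
  | arc (c : ℕ) (l : List G.Dart) : Strand

variable {G}

namespace Strand

def color : G.Strand → ℕ
  | closed c _ => c
  | arc c _ => c

/-- The strand runs along the dart `d` (in the direction of `d`). -/
def Uses : G.Strand → G.Dart → Prop
  | closed _ γ, d => d ∈ γ
  | arc _ l, d => d ∈ l

/-- the vertices through which the strand passes, including endpoints -/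
def vertices (s : G.Strand) : Set G.Vertex := {v | ∃ d, s.Uses d ∧ (tail d = v ∨ head d = v)}

/-- A strand is a color in `{1, …, n - 1}` and a directed path in the graph without repeated
vertices or edges that is closed or has both endpoints on the boundary. -/
def IsProper : G.Strand → Prop
  | closed c γ => (1 ≤ c ∧ c < n) ∧ γ ≠ Cycle.nil ∧ γ.Chain (fun d d' => head d = tail d') ∧
      (γ.map fun d => tail d).Nodup ∧ (γ.map fun d => d.1).Nodup
  | arc c l => (1 ≤ c ∧ c < n) ∧ l ≠ [] ∧ ∃ i j : Fin G.bd,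
      G.IsWalk (Sum.inl i) l (Sum.inl j) ∧
      ((Sum.inl i : G.Vertex) :: l.map fun d => head d).Nodup ∧ (l.map fun d => d.1).Nodup

end Strand

/-- A stranding: a collection of strands in which strands of the same color are disjoint. -/
def IsStranding (S : Set G.Strand) : Prop :=
  (∀ s ∈ S, s.IsProper) ∧
  ∀ s ∈ S, ∀ t ∈ S, s ≠ t → s.color = t.color → Disjoint s.vertices t.vertices

/-- colors of the strands running along `e` in the direction of `e` -/
def posColors (S : Set G.Strand) (e : G.E) : Set ℕ :=
  {c | ∃ s ∈ S, s.color = c ∧ s.Uses (e, true)}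

/-- colors of the strands running along `e` against the direction of `e` -/
def negColors (S : Set G.Strand) (e : G.E) : Set ℕ :=
  {c | ∃ s ∈ S, s.color = c ∧ s.Uses (e, false)}

def colors (S : Set G.Strand) (e : G.E) : Set ℕ := posColors S e ∪ negColors S e

open Classical in
/-- the sign with which the color `c` appears on the edge `e` -/
noncomputable def coroot (S : Set G.Strand) (c : ℕ) (e : G.E) : ℤ :=
  if c ∈ posColors S e then 1 else if c ∈ negColors S e then -1 else 0

/-- Validity on an edge: the strands, ordered by color, alternate in direction, and the signed sum
of the colors is the weight `ℓ` or `ℓ - n`, according to the direction of the strand of largest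
color (in particular there is at least one strand). -/
def IsValidOn (S : Set G.Strand) (e : G.E) : Prop :=
  (∀ c ∈ colors S e, ∀ c' ∈ colors S e, c < c' → (∀ x ∈ colors S e, ¬ (c < x ∧ x < c')) →
    coroot S c e * coroot S c' e = -1) ∧
  ∃ cmax, IsGreatest (colors S e) cmax ∧
    (cmax ∈ posColors S e → ∑ c ∈ Finset.Ico 1 n, coroot S c e * (c : ℤ) = (G.weight e : ℤ)) ∧
    (cmax ∈ negColors S e → ∑ c ∈ Finset.Ico 1 n, coroot S c e * (c : ℤ) = (G.weight e : ℤ) - n)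

def IsValidStranding (S : Set G.Strand) : Prop :=
  IsStranding S ∧ ∀ e : G.E, IsValidOn S e

/-! ### The base stranding -/

variable (G)

/-- One step of the clockwise walk around the face on the right of `d`: go along `d`, then turn
right as sharply as possible (at a boundary vertex: go along the axis to the next boundary
vertex that belongs to the face). -/
def next (d : G.Dart) : G.Dart := G.rot (rev d)

/-- The base stranding.  Around each face `A` with `dist outer A ≠ 0` insert strands of
color `dist outer A` along the boundary of `A`, clockwise, that is, with `A` on the right:
a closed strand for each boundary component that does not meet the axis; and for those that do,
the arcs that are left when the portions on the axis are erased, that is, all walks from a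
boundary vertex, with `A` on the right, to the first boundary vertex that is reached. -/
def baseStranding : Set G.Strand :=
  {s | ∃ d : G.Dart, G.dist G.outer (G.right d) ≠ 0 ∧
    (∀ k : ℕ, ¬ IsBoundary (head (G.next^[k] d))) ∧
    s = Strand.closed (G.dist G.outer (G.right d)) (Function.periodicOrbit G.next d)} ∪
  {s | ∃ (i : Fin G.bd) (k : ℕ), G.dist G.outer (G.right (G.leg i)) ≠ 0 ∧
    (∀ j < k, ¬ IsBoundary (head (G.next^[j] (G.leg i)))) ∧
    IsBoundary (head (G.next^[k] (G.leg i))) ∧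
    s = Strand.arc (G.dist G.outer (G.right (G.leg i)))
      ((List.range (k + 1)).map fun j => G.next^[j] (G.leg i))}

end Web

/-! The weights modulo `n` form a flow on a graph drawn on the sphere. It is conserved at interior
vertices by hypothesis and at the collapsed axis because divergences sum to zero. The first
cohomology of the sphere vanishes, so the flow is the difference across edges of a potential `f` on
the faces (`PlaneGraph.range_faceDiff`, proved by counting over `ZMod n` with Euler's formula).
Hence distances are differences of `f`, independent of the path.

Let `b` and `a` be the colors in `{0, …, n - 1}` of the faces to the right and left of an edge of
weight `ℓ`. Then `b ≡ a + ℓ` modulo `n` with `0 < ℓ < n`, so `a ≠ b`. The edge carries color `b`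
forwards and color `a` backwards, color `0` being omitted, and `b - a` is `ℓ` or `ℓ - n` according
to which is larger. This is validity.

Any two of the three sectors at a trivalent vertex share an edge, so their colors differ
(`eq_of_tail_eq_of_rightColor_eq`). Hence strands of one color neither meet nor revisit a vertex. -/

namespace BoundaryGraph

/-! ### Darts, and flows with their divergence -/

variable {G : BoundaryGraph}

@[simp] theorem rev_rev (d : G.Dart) : rev (rev d) = d := by simp [rev]

@[simp] theorem tail_rev (d : G.Dart) : tail (rev d) = head d := rfl

@[simp] theorem head_rev (d : G.Dart) : head (rev d) = tail d := by simp [head]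

theorem eq_or_eq_rev_of_fst_eq {d d' : G.Dart} (h : d.1 = d'.1) : d' = d ∨ d' = rev d := by
  rcases d with ⟨e, _ | _⟩ <;> rcases d' with ⟨e', _ | _⟩ <;> simp_all [rev]

theorem collapse_eq_none_iff {v : G.Vertex} : collapse v = none ↔ IsBoundary v := by
  rcases v with i | v <;> simp [collapse, IsBoundary]

theorem collapse_eq_some_iff {v : G.Vertex} {x : G.V} :
    collapse v = some x ↔ v = Sum.inr x := by
  rcases v with i | v <;> simp [collapse]

theorem eq_of_collapse_eq {v w : G.Vertex} (hv : ¬ IsBoundary v) (h : collapse w = collapse v) :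
    w = v := by
  rcases v with i | v
  · exact absurd ⟨i, rfl⟩ hv
  · exact collapse_eq_some_iff.1 h

variable {R : Type} [CommRing R]

/-- The antisymmetric extension to darts of a function on edges. -/
def onDart (w : G.E → R) (d : G.Dart) : R := if d.2 then w d.1 else -w d.1

variable (G R)

/-- The net flow out of each vertex of the graph in which the axis is collapsed. -/
def divergence : (G.E → R) →ₗ[R] (Option G.V → R) :=
  ∑ e, ((LinearMap.single R (fun _ : Option G.V => R) (collapse (tail (e, true) : G.Vertex)) -
    LinearMap.single R (fun _ : Option G.V => R) (collapse (tail (e, false) : G.Vertex))) ∘ₗ LinearMap.proj e)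

variable {G R}

theorem divergence_eq (w : G.E → R) : G.divergence R w =
    ∑ e, (Pi.single (collapse (tail (e, true) : G.Vertex)) (w e) -
      Pi.single (collapse (tail (e, false) : G.Vertex)) (w e)) := by
  simp [divergence]

theorem divergence_apply (w : G.E → R) (x : Option G.V) :
    G.divergence R w x = ∑ d : G.Dart with collapse (tail d) = x, onDart w d := by
  rw [divergence_eq, Finset.sum_filter, Fintype.sum_prod_type, Finset.sum_apply]
  refine Finset.sum_congr rfl fun e _ => ?_
  simp only [Fintype.sum_bool, onDart, Pi.sub_apply, Pi.single_apply, eq_comm (a := x)]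
  split_ifs <;> simp_all

/-- Each edge contributes once with each sign. This yields conservation at the collapsed axis from
conservation at all other vertices. -/
theorem sum_divergence (w : G.E → R) : ∑ x, G.divergence R w x = 0 := by
  simp only [divergence_eq, Finset.sum_apply]
  rw [Finset.sum_comm]
  refine Finset.sum_eq_zero fun e _ => ?_
  simp [Finset.sum_sub_distrib]

theorem divergence_single (d : G.Dart) (r : R) :
    G.divergence R (Pi.single d.1 (if d.2 then r else -r)) =
      Pi.single (collapse (tail d)) r - Pi.single (collapse (head d)) r := by
  rw [divergence_eq, Finset.sum_eq_single d.1]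
  · rcases d with ⟨e, _ | _⟩ <;> simp [head, rev, Pi.single_neg, sub_eq_add_neg, add_comm]
  · intro e _ he
    simp [Pi.single_eq_of_ne he]
  · simp

/-- Modulo flows, a chain on the vertices can be moved to one vertex of each component. -/
theorem card_vertices_le [Finite R] :
    Nat.card R ^ (Fintype.card G.V + 1) ≤
      Nat.card (LinearMap.range (G.divergence R)) * Nat.card R ^ G.numComponents := by
  classical
  let r : Option G.V → Option G.V → Prop :=
    fun x y => ∃ d : G.Dart, x = collapse (tail d) ∧ y = collapse (head d)
  let Q := Quot r
  have : Finite Q := Finite.of_surjective _ (Quot.mk_surjective (r := r))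
  have : Fintype Q := Fintype.ofFinite Q
  -- `φ` puts one coefficient at a chosen representative of each component.
  let φ : (Q → R) →ₗ[R] (Option G.V → R) :=
    ∑ q, LinearMap.single R (fun _ : Option G.V => R) q.out ∘ₗ LinearMap.proj q
  have hφ : ∀ q a, φ (Pi.single q a) = Pi.single q.out a := by
    intro q a
    simp only [φ, LinearMap.sum_apply, LinearMap.comp_apply, LinearMap.proj_apply,
      LinearMap.single_apply]
    rw [Finset.sum_eq_single q]
    · simp
    · intro p _ hp
      simp [Pi.single_eq_of_ne hp]
    · simp
  -- A mass can be moved along any path of edges at the cost of a divergence.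
  have hr : ∀ x y, Relation.EqvGen r x y → ∀ a : R,
      (Pi.single x a - Pi.single y a : Option G.V → R) ∈ LinearMap.range (G.divergence R) := by
    intro x y h
    induction h with
    | rel x y h =>
      obtain ⟨d, rfl, rfl⟩ := h
      exact fun a => ⟨_, divergence_single d a⟩
    | refl x => simp
    | symm x y _ ih => exact fun a => by simpa using neg_mem (ih a)
    | trans x y z _ _ ih ih' => exact fun a => by simpa using add_mem (ih a) (ih' a)
  have hsup : LinearMap.range (G.divergence R) ⊔ LinearMap.range φ = ⊤ := by
    rw [eq_top_iff]
    intro g _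
    rw [← Finset.univ_sum_single g]
    refine sum_mem fun x _ => ?_
    have h := hr x (Quot.mk r x).out (Quot.eqvGen_exact (Quot.out_eq _).symm) (g x)
    simpa using add_mem (Submodule.mem_sup_left h)
      (Submodule.mem_sup_right (T := LinearMap.range φ) ⟨_, hφ (Quot.mk r x) (g x)⟩)
  have hsurj : Function.Surjective
      (fun p : LinearMap.range (G.divergence R) × (Q → R) => (p.1 : Option G.V → R) + φ p.2) := by
    intro g
    obtain ⟨a, ha, _, ⟨c, rfl⟩, h⟩ := Submodule.mem_sup.1 (hsup ▸ Submodule.mem_top (x := g))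
    exact ⟨(⟨a, ha⟩, c), h⟩
  have h := Nat.card_le_card_of_surjective _ hsurj
  rw [Nat.card_prod, Nat.card_fun, Nat.card_fun] at h
  simpa [numComponents, Q, r] using h

end BoundaryGraph

/-! ### Potentials on the faces and vanishing of cohomology -/

namespace PlaneGraph

open BoundaryGraph

variable (G : PlaneGraph) (R : Type) [CommRing R]

/-- The differences of a function on the faces across the edges. -/
def faceDiff : (G.F → R) →ₗ[R] (G.E → R) :=
  LinearMap.funLeft R R (fun e => G.right (e, true)) -
    LinearMap.funLeft R R (fun e => G.right (e, false))

variable {G R}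

theorem faceDiff_apply (f : G.F → R) (e : G.E) :
    G.faceDiff R f e = f (G.right (e, true)) - f (G.right (e, false)) := rfl

theorem onDart_faceDiff (f : G.F → R) (d : G.Dart) :
    onDart (G.faceDiff R f) d = f (G.right d) - f (G.right (rev d)) := by
  rcases d with ⟨e, _ | _⟩ <;> simp [onDart, faceDiff_apply, rev]

theorem right_rot (d : G.Dart) : G.right (G.rot d) = G.right (rev d) := by
  simpa using G.right_next (rev d)

theorem collapse_tail_rot (d : G.Dart) : collapse (tail (G.rot d)) = collapse (tail d) :=
  ((G.rot_sameCycle_iff _ _).1 (Equiv.Perm.sameCycle_apply_left.2 (.refl _ _)))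

/-- The left face of a dart is the right face of the next dart around the vertex, so the differences
cancel after reindexing by `rot`. -/
theorem divergence_faceDiff (f : G.F → R) :
    G.toBoundaryGraph.divergence R (G.faceDiff R f) = 0 := by
  ext x
  rw [divergence_apply]
  simp only [onDart_faceDiff, Finset.sum_sub_distrib, Pi.zero_apply, sub_eq_zero, ← right_rot]
  symm
  refine Finset.sum_equiv G.rot (fun d => ?_) (fun d _ => rfl)
  simp [collapse_tail_rot]

/-- Since the dual graph is connected, the kernel consists of the constants. -/
theorem card_ker_faceDiff : Nat.card (LinearMap.ker (G.faceDiff R)) = Nat.card R := by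
  refine Nat.card_congr ⟨fun f => f.1 G.outer, fun r => ⟨fun _ => r, ?_⟩, ?_, fun r => rfl⟩
  · ext e
    simp [faceDiff_apply]
  · rintro ⟨f, hf⟩
    ext A
    change f G.outer = f A
    induction G.faces_connected G.outer A with
    | refl => rfl
    | tail _ h ih =>
      obtain ⟨d, rfl, rfl⟩ := h
      rw [ih, eq_comm, ← sub_eq_zero, ← onDart_faceDiff, LinearMap.mem_ker.1 hf]
      simp [onDart]

/-- First cohomology of the sphere vanishes: a conservative flow is the difference of a function
on the faces. -/
theorem range_faceDiff [Finite R] [Nontrivial R] :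
    LinearMap.range (G.faceDiff R) = LinearMap.ker (G.toBoundaryGraph.divergence R) := by
  have hle : LinearMap.range (G.faceDiff R) ≤ LinearMap.ker (G.toBoundaryGraph.divergence R) := by
    rintro _ ⟨f, rfl⟩
    exact divergence_faceDiff f
  refine SetLike.coe_injective (Set.eq_of_subset_of_ncard_le hle ?_ (Set.toFinite _))
  -- Rank-nullity in terms of cardinalities, which needs no field: `ZMod n` is only a finite ring.
  have hcard : ∀ {M N : Type} [AddCommGroup M] [AddCommGroup N] [Module R M] [Module R N]
      (g : M →ₗ[R] N), Nat.card M = Nat.card (LinearMap.range g) * Nat.card (LinearMap.ker g) := by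
    intro M N _ _ _ _ g
    rw [Submodule.card_eq_card_quotient_mul_card (LinearMap.ker g),
      Nat.card_congr g.quotKerEquivRange.toEquiv, mul_comm]
  have h1 := hcard (G.faceDiff R)
  have h2 := hcard (G.toBoundaryGraph.divergence R)
  have h3 := card_vertices_le (G := G.toBoundaryGraph) (R := R)
  rw [card_ker_faceDiff, Nat.card_fun, Nat.card_eq_fintype_card (α := G.F)] at h1
  rw [Nat.card_fun, Nat.card_eq_fintype_card (α := G.E)] at h2
  change Nat.card (LinearMap.ker (G.toBoundaryGraph.divergence R)) ≤
    Nat.card (LinearMap.range (G.faceDiff R))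
  have hR : 0 < Nat.card R := Nat.card_pos
  have heuler := G.euler
  set q := Nat.card R
  set a := Nat.card (LinearMap.range (G.faceDiff R))
  set b := Nat.card (LinearMap.range (G.toBoundaryGraph.divergence R))
  set k := Nat.card (LinearMap.ker (G.toBoundaryGraph.divergence R))
  -- Multiplying by this power replaces the exponent `#E - (#V + 1) + #components`, which is `#F -
  -- 1` by Euler's formula, by sums of natural numbers.
  refine Nat.le_of_mul_le_mul_right (c := q ^ (Fintype.card G.V + 1)) ?_ (by positivity)
  calc k * q ^ (Fintype.card G.V + 1) ≤ k * (b * q ^ G.numComponents) := by gcongr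
    _ = q ^ Fintype.card G.E * q ^ G.numComponents := by rw [h2]; ring
    _ = q ^ Fintype.card G.F * q ^ Fintype.card G.V := by
      rw [← pow_add, ← pow_add]; congr 1; omega
    _ = a * q ^ (Fintype.card G.V + 1) := by rw [h1]; ring

theorem exists_faceDiff_eq [Finite R] [Nontrivial R] (w : G.E → R)
    (hw : ∀ v : G.V, ∑ d : G.Dart with tail d = Sum.inr v, onDart w d = 0) :
    ∃ f, G.faceDiff R f = w := by
  have hsome : ∀ v : G.V, G.toBoundaryGraph.divergence R w (some v) = 0 := by
    intro v
    rw [divergence_apply, ← hw v]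
    simp only [collapse_eq_some_iff]
  have hmem : w ∈ LinearMap.ker (G.toBoundaryGraph.divergence R) := by
    ext x
    rcases x with _ | v
    · simpa [Fintype.sum_option, hsome] using sum_divergence w
    · exact hsome v
  rwa [← range_faceDiff] at hmem

end PlaneGraph

namespace Web

open BoundaryGraph

variable {n : ℕ} {G : Web n}

/-! ### The distance is a potential -/

theorem intCast_stepWeight (d : G.Dart) :
    (G.stepWeight d : ZMod n) = onDart (fun e => (G.weight e : ZMod n)) d := by
  rcases d with ⟨e, _ | _⟩ <;> simp [stepWeight, onDart]

variable (G) in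
theorem exists_potential (hn : 2 ≤ n) :
    ∃ f : G.F → ZMod n, ∀ d, f (G.right d) - f (G.left d) = (G.stepWeight d : ZMod n) := by
  have : NeZero n := ⟨by omega⟩
  have : Fact (1 < n) := ⟨hn⟩
  obtain ⟨f, hf⟩ := G.exists_faceDiff_eq (fun e => (G.weight e : ZMod n)) fun v => by
    have h := (ZMod.intCast_eq_intCast_iff _ _ _).2 (G.conservation v)
    -- `conservation` counts incoming ends positively, `onDart` outgoing ones.
    rw [Int.cast_zero, ← neg_eq_zero, Int.cast_sum, ← Finset.sum_neg_distrib] at h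
    rw [← h]
    refine Finset.sum_congr rfl fun d _ => ?_
    rcases d with ⟨e, _ | _⟩ <;> simp [onDart]
  refine ⟨f, fun d => ?_⟩
  rw [intCast_stepWeight, ← hf, PlaneGraph.onDart_faceDiff, left]

/-- The step weights telescope, so only the end faces matter. -/
theorem intCast_distAlong_eq {f : G.F → ZMod n}
    (hf : ∀ d, f (G.right d) - f (G.left d) = (G.stepWeight d : ZMod n))
    {A B : G.F} {P : List G.Dart} (h : G.IsDualPath A P B) :
    ((P.map G.stepWeight).sum : ZMod n) = f B - f A := by
  induction P generalizing A with
  | nil => cases h; simp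
  | cons d P ih =>
    obtain ⟨rfl, h⟩ := h
    simp [ih h, ← hf]

theorem distAlong_eq_val [NeZero n] {f : G.F → ZMod n}
    (hf : ∀ d, f (G.right d) - f (G.left d) = (G.stepWeight d : ZMod n))
    {A B : G.F} {P : List G.Dart} (h : G.IsDualPath A P B) :
    G.distAlong P = (f B - f A).val := by
  rw [← intCast_distAlong_eq hf h, distAlong, ← ZMod.val_intCast, Int.toNat_natCast]

theorem dist_eq_val [NeZero n] {f : G.F → ZMod n}
    (hf : ∀ d, f (G.right d) - f (G.left d) = (G.stepWeight d : ZMod n)) (A B : G.F) :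
    G.dist A B = (f B - f A).val :=
  distAlong_eq_val hf (G.exists_isDualPath A B).choose_spec

theorem distAlong_eq_dist (hn : 2 ≤ n) {A B : G.F} {P : List G.Dart} (h : G.IsDualPath A P B) :
    G.distAlong P = G.dist A B := by
  have : NeZero n := ⟨by omega⟩
  obtain ⟨f, hf⟩ := G.exists_potential hn
  rw [distAlong_eq_val hf h, dist_eq_val hf]

/-! ### The color of a dart in the base stranding -/

/-- the color of the strand with which the face on the right of a dart is surrounded -/
noncomputable def rightColor (d : G.Dart) : ℕ := G.dist G.outer (G.right d)

theorem rightColor_lt (hn : 2 ≤ n) (d : G.Dart) : rightColor d < n := by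
  have : NeZero n := ⟨by omega⟩
  obtain ⟨f, hf⟩ := G.exists_potential hn
  rw [rightColor, dist_eq_val hf]
  exact ZMod.val_lt _

theorem rightColor_modEq (hn : 2 ≤ n) (e : G.E) :
    rightColor ((e, true) : G.Dart) ≡ rightColor ((e, false) : G.Dart) + G.weight e [MOD n] := by
  have : NeZero n := ⟨by omega⟩
  obtain ⟨f, hf⟩ := G.exists_potential hn
  rw [← ZMod.natCast_eq_natCast_iff]
  have h := hf (e, true)
  simp only [stepWeight, left, rev, Bool.not_true, if_true, Int.cast_natCast] at h
  simp [rightColor, dist_eq_val hf, ← h]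

/-- Equal colors would make the weight divisible by `n`, although it lies strictly between `0` and
`n`. -/
theorem rightColor_true_ne_false (hn : 2 ≤ n) (e : G.E) :
    rightColor ((e, true) : G.Dart) ≠ rightColor ((e, false) : G.Dart) := by
  intro h
  have h1 := rightColor_modEq hn e
  rw [h] at h1
  have h2 : 0 ≡ G.weight e [MOD n] := Nat.ModEq.add_left_cancel' _ h1
  rw [Nat.ModEq, Nat.zero_mod, Nat.mod_eq_of_lt (G.weight_lt e)] at h2
  exact absurd (G.one_le_weight e) (by omega)

theorem rightColor_rev_ne (hn : 2 ≤ n) (d : G.Dart) : rightColor (rev d) ≠ rightColor d := by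
  rcases d with ⟨e, _ | _⟩
  · exact rightColor_true_ne_false hn e
  · exact (rightColor_true_ne_false hn e).symm

theorem rightColor_rot (d : G.Dart) : rightColor (G.rot d) = rightColor (rev d) := by
  rw [rightColor, PlaneGraph.right_rot, rightColor]

theorem rightColor_rot_ne (hn : 2 ≤ n) (d : G.Dart) : rightColor (G.rot d) ≠ rightColor d :=
  rightColor_rot d ▸ rightColor_rev_ne hn d

/-- The faces around a vertex have different colors. -/
theorem eq_of_tail_eq_of_rightColor_eq (hn : 2 ≤ n) {d d' : G.Dart} (ht : tail d = tail d')
    (hc : rightColor d = rightColor d') : d = d' := by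
  rcases hv : tail d with i | v
  · rw [(G.tail_eq_inl_iff d i).1 hv, (G.tail_eq_inl_iff d' i).1 (ht ▸ hv)]
  have hv' : tail d' = Sum.inr v := ht ▸ hv
  rcases G.trivalent_or_circle v with h3 | ⟨e, he⟩
  -- Consecutive darts differ in color, so two distinct darts of equal color and their successors
  -- under `rot` would be four distinct darts at a vertex of valence three.
  · by_contra hne
    have hrot : ∀ x : G.Dart, tail x = Sum.inr v → tail (G.rot x) = Sum.inr v := fun x hx => by
      rw [← collapse_eq_some_iff, PlaneGraph.collapse_tail_rot, hx]
      rfl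
    have h1 : G.rot d ≠ d := fun h => rightColor_rot_ne hn d (by rw [h])
    have h2 : G.rot d' ≠ d' := fun h => rightColor_rot_ne hn d' (by rw [h])
    have h3' : G.rot d ≠ d' := fun h => rightColor_rot_ne hn d (by rw [h, hc])
    have h4 : G.rot d' ≠ d := fun h => rightColor_rot_ne hn d' (by rw [h, hc])
    have h5 : G.rot d ≠ G.rot d' := fun h => hne (G.rot.injective h)
    have hsub : ({d, d', G.rot d, G.rot d'} : Finset G.Dart) ⊆
        Finset.univ.filter fun x : G.Dart => tail x = Sum.inr v := by
      intro x hx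
      simp only [Finset.mem_insert, Finset.mem_singleton] at hx
      rw [Finset.mem_filter]
      rcases hx with rfl | rfl | rfl | rfl <;> simp [hv, hv', hrot]
    have hle := Finset.card_le_card hsub
    rw [← Fintype.card_subtype, h3, Finset.card_insert_of_notMem, Finset.card_insert_of_notMem,
      Finset.card_pair h5] at hle
    · omega
    · simp [h2.symm, h3'.symm]
    · simp [hne, h1.symm, h4.symm]
  · rcases eq_or_eq_rev_of_fst_eq (((he d).1 hv).trans ((he d').1 hv').symm) with h | h
    · exact h.symm
    · exact absurd (h ▸ hc.symm) (rightColor_rev_ne hn d)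

/-! ### The clockwise walk around a face -/

theorem next_injective : Function.Injective G.next := fun d d' h => by
  simpa using congrArg rev (G.rot.injective h)

theorem mem_periodicPts_next (d : G.Dart) : d ∈ Function.periodicPts G.next :=
  next_injective.mem_periodicPts d

theorem rightColor_next (d : G.Dart) : rightColor (G.next d) = rightColor d := by
  rw [rightColor, next, G.right_next, rightColor]

theorem rightColor_iterate_next (d : G.Dart) (k : ℕ) :
    rightColor (G.next^[k] d) = rightColor d := by
  induction k with
  | zero => rfl
  | succ k ih => rw [Function.iterate_succ_apply', rightColor_next, ih]

theorem collapse_tail_next (d : G.Dart) : collapse (tail (G.next d)) = collapse (head d) := by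
  rw [next, PlaneGraph.collapse_tail_rot, tail_rev]

theorem tail_next {d : G.Dart} (h : ¬ IsBoundary (head d)) : tail (G.next d) = head d :=
  eq_of_collapse_eq h (collapse_tail_next d)

theorem isBoundary_tail_next {d : G.Dart} :
    IsBoundary (tail (G.next d)) ↔ IsBoundary (head d) := by
  rw [← collapse_eq_none_iff, collapse_tail_next, collapse_eq_none_iff]

theorem isBoundary_tail_iff {d : G.Dart} : IsBoundary (tail d) ↔ ∃ i, d = G.leg i :=
  exists_congr fun i => G.tail_eq_inl_iff d i

theorem tail_leg (i : Fin G.bd) : tail (G.leg i) = Sum.inl i := (G.tail_eq_inl_iff _ i).2 rfl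

theorem next_ne_leg {d : G.Dart} (h : ¬ IsBoundary (head d)) (i : Fin G.bd) :
    G.next d ≠ G.leg i :=
  fun hd => h (isBoundary_tail_next.1 (isBoundary_tail_iff.2 ⟨i, hd⟩))

/-- Away from the axis `next` turns heads into tails without changing colors. On the axis it jumps
to another leg in general, but there the vertex is univalent. -/
theorem eq_of_head_eq_of_rightColor_eq (hn : 2 ≤ n) {d d' : G.Dart} (hh : head d = head d')
    (hc : rightColor d = rightColor d') : d = d' := by
  by_cases hb : IsBoundary (head d)
  · obtain ⟨i, hi⟩ := hb
    have h := (G.tail_eq_inl_iff (rev d) i).1 hi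
    have h' := (G.tail_eq_inl_iff (rev d') i).1 (hh.symm.trans hi)
    simpa using congrArg rev (h.trans h'.symm)
  · refine next_injective (eq_of_tail_eq_of_rightColor_eq hn ?_ ?_)
    · rw [tail_next hb, tail_next (hh ▸ hb), hh]
    · rw [rightColor_next, rightColor_next, hc]

theorem eq_of_fst_eq_of_rightColor_eq (hn : 2 ≤ n) {d d' : G.Dart} (hh : d.1 = d'.1)
    (hc : rightColor d = rightColor d') : d = d' := by
  rcases eq_or_eq_rev_of_fst_eq hh with h | h
  · exact h.symm
  · exact absurd (h ▸ hc.symm) (rightColor_rev_ne hn d)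

/-- The walk around a face does not meet the axis. -/
def AvoidsAxis (d : G.Dart) : Prop := ∀ k : ℕ, ¬ IsBoundary (head (G.next^[k] d))

/-- The walk along the face to the right of the `i`-th leg meets the axis first after having
travelled along `k + 1` darts. -/
def ReachesAxis (i : Fin G.bd) (k : ℕ) : Prop :=
  (∀ j < k, ¬ IsBoundary (head (G.next^[j] (G.leg i)))) ∧
    IsBoundary (head (G.next^[k] (G.leg i)))

/-- the part of the walk described in `ReachesAxis` -/
def arcWalk (i : Fin G.bd) (k : ℕ) : List G.Dart :=
  (List.range (k + 1)).map fun j => G.next^[j] (G.leg i)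

theorem mem_baseStranding {s : G.Strand} : s ∈ G.baseStranding ↔
    (∃ d : G.Dart, rightColor d ≠ 0 ∧ AvoidsAxis d ∧
      s = Strand.closed (rightColor d) (Function.periodicOrbit G.next d)) ∨
    ∃ (i : Fin G.bd) (k : ℕ), rightColor (G.leg i) ≠ 0 ∧ ReachesAxis i k ∧
      s = Strand.arc (rightColor (G.leg i)) (arcWalk i k) := by
  simp only [baseStranding, Set.mem_union, Set.mem_ofPred_eq, AvoidsAxis, ReachesAxis, and_assoc]
  rfl

theorem mem_periodicOrbit_next {d d' : G.Dart} :
    d' ∈ Function.periodicOrbit G.next d ↔ ∃ k, G.next^[k] d = d' :=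
  Function.mem_periodicOrbit_iff (mem_periodicPts_next d)

theorem mem_arcWalk {i : Fin G.bd} {k : ℕ} {d : G.Dart} :
    d ∈ arcWalk i k ↔ ∃ j ≤ k, G.next^[j] (G.leg i) = d := by
  simp only [arcWalk, List.mem_map, List.mem_range, Nat.lt_succ_iff]

theorem ReachesAxis.iterate_ne_leg {i : Fin G.bd} {k : ℕ} (h : ReachesAxis i k) {j : ℕ}
    (hj : j < k) (i' : Fin G.bd) : G.next^[j + 1] (G.leg i) ≠ G.leg i' := by
  rw [Function.iterate_succ_apply']
  exact next_ne_leg (h.1 j hj) i'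

/-- Undoing `j'` steps leaves a walk from leg `i` to leg `i'` of length `j - j'`, which must be zero
before the axis is reached. With `i = i'` this shows that an arc repeats no dart; in general, that
different arcs share none. -/
theorem ReachesAxis.eq_of_iterate_eq {i i' : Fin G.bd} {k j j' : ℕ} (h : ReachesAxis i k)
    (hj : j ≤ k) (hjj : j' ≤ j) (heq : G.next^[j] (G.leg i) = G.next^[j'] (G.leg i')) :
    j = j' ∧ i = i' := by
  obtain ⟨m, rfl⟩ := Nat.exists_eq_add_of_le hjj
  rw [Function.iterate_add_apply] at heq
  have h1 := next_injective.iterate j' heq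
  rcases m with _ | m
  · refine ⟨rfl, ?_⟩
    have h2 := congrArg tail h1
    simpa [tail_leg] using h2
  · exact absurd h1 (h.iterate_ne_leg (by omega) i')

theorem ReachesAxis.length_unique {i : Fin G.bd} {k k' : ℕ} (h : ReachesAxis i k)
    (h' : ReachesAxis i k') : k = k' := by
  rcases lt_trichotomy k k' with hlt | rfl | hlt
  · exact absurd h.2 (h'.1 k hlt)
  · rfl
  · exact absurd h'.2 (h.1 k' hlt)

theorem ReachesAxis.iterate_injOn {i : Fin G.bd} {k j j' : ℕ} (h : ReachesAxis i k)
    (hj : j ≤ k) (hj' : j' ≤ k) (heq : G.next^[j] (G.leg i) = G.next^[j'] (G.leg i)) :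
    j = j' := by
  rcases le_total j' j with hle | hle
  · exact (h.eq_of_iterate_eq hj hle heq).1
  · exact (h.eq_of_iterate_eq hj' hle heq.symm).1.symm

theorem ReachesAxis.arcWalk_nodup {i : Fin G.bd} {k : ℕ} (h : ReachesAxis i k) :
    (arcWalk i k).Nodup := by
  refine List.Nodup.map_on (fun j hj j' hj' heq => ?_) List.nodup_range
  rw [List.mem_range] at hj hj'
  exact h.iterate_injOn (by omega) (by omega) heq

theorem isWalk_iterate_next (d : G.Dart) (k : ℕ)
    (h : ∀ j < k, ¬ IsBoundary (head (G.next^[j] d))) :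
    G.IsWalk (tail d) ((List.range (k + 1)).map fun j => G.next^[j] d)
      (head (G.next^[k] d)) := by
  induction k generalizing d with
  | zero => exact ⟨rfl, rfl⟩
  | succ k ih =>
    rw [List.range_succ_eq_map, List.map_cons, List.map_map]
    refine ⟨rfl, ?_⟩
    have h0 : ¬ IsBoundary (head d) := h 0 (Nat.succ_pos k)
    have := ih (G.next d) fun j hj => by
      rw [← Function.iterate_succ_apply]
      exact h (j + 1) (by omega)
    rw [tail_next h0] at this
    exact this

/-! ### The strands of the base stranding -/

theorem rightColor_eq_color {s : G.Strand} (hs : s ∈ G.baseStranding) {d : G.Dart}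
    (hd : s.Uses d) : rightColor d = s.color := by
  rcases mem_baseStranding.1 hs with ⟨d₀, _, _, rfl⟩ | ⟨i, k, _, _, rfl⟩
  · obtain ⟨k, rfl⟩ := mem_periodicOrbit_next.1 hd
    exact rightColor_iterate_next _ _
  · obtain ⟨j, _, rfl⟩ := mem_arcWalk.1 hd
    exact rightColor_iterate_next _ _

theorem color_ne_zero {s : G.Strand} (hs : s ∈ G.baseStranding) : s.color ≠ 0 := by
  rcases mem_baseStranding.1 hs with ⟨d₀, h, _, rfl⟩ | ⟨i, k, h, _, rfl⟩ <;> exact h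

/-- Following the walk from any dart of an arc leads to the axis. -/
theorem not_uses_of_avoidsAxis {d₀ d : G.Dart} (h : AvoidsAxis d₀) {k : ℕ}
    (hk : G.next^[k] d₀ = d) {i : Fin G.bd} {m : ℕ} (hi : ReachesAxis i m) :
    d ∉ arcWalk i m := by
  intro hd
  obtain ⟨j, hj, hd⟩ := mem_arcWalk.1 hd
  refine h (m - j + k) ?_
  rw [Function.iterate_add_apply, hk, ← hd, ← Function.iterate_add_apply, Nat.sub_add_cancel hj]
  exact hi.2

/-- Different strands of the base stranding have no dart in common. -/
theorem eq_of_uses {s t : G.Strand} (hs : s ∈ G.baseStranding) (ht : t ∈ G.baseStranding)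
    {d : G.Dart} (hsd : s.Uses d) (htd : t.Uses d) : s = t := by
  have hc : s.color = t.color := by rw [← rightColor_eq_color hs hsd, ← rightColor_eq_color ht htd]
  rcases mem_baseStranding.1 hs with ⟨d₁, _, h₁, rfl⟩ | ⟨i, k, _, h₁, rfl⟩ <;>
    rcases mem_baseStranding.1 ht with ⟨d₂, _, h₂, rfl⟩ | ⟨i', k', _, h₂, rfl⟩
  · obtain ⟨k₁, hk₁⟩ := mem_periodicOrbit_next.1 hsd
    obtain ⟨k₂, hk₂⟩ := mem_periodicOrbit_next.1 htd
    change rightColor d₁ = rightColor d₂ at hc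
    rw [hc, ← Function.periodicOrbit_apply_iterate_eq (mem_periodicPts_next d₁) k₁, hk₁, ← hk₂,
      Function.periodicOrbit_apply_iterate_eq (mem_periodicPts_next d₂) k₂]
  · obtain ⟨k₁, hk₁⟩ := mem_periodicOrbit_next.1 hsd
    exact absurd htd (not_uses_of_avoidsAxis h₁ hk₁ h₂)
  · obtain ⟨k₂, hk₂⟩ := mem_periodicOrbit_next.1 htd
    exact absurd hsd (not_uses_of_avoidsAxis h₂ hk₂ h₁)
  · obtain ⟨j, hj, hd⟩ := mem_arcWalk.1 hsd
    obtain ⟨j', hj', hd'⟩ := mem_arcWalk.1 htd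
    have hi : i = i' := by
      rcases le_total j' j with hle | hle
      · exact (h₁.eq_of_iterate_eq hj hle (hd.trans hd'.symm)).2
      · exact (h₂.eq_of_iterate_eq hj' hle (hd'.trans hd.symm)).2.symm
    subst hi
    rw [h₁.length_unique h₂]

/-- Every dart to the right of which there is a colored face is used by a strand. -/
theorem exists_uses {d : G.Dart} (hd : rightColor d ≠ 0) : ∃ s ∈ G.baseStranding, s.Uses d := by
  classical
  by_cases h : AvoidsAxis d
  · exact ⟨_, mem_baseStranding.2 (.inl ⟨d, hd, h, rfl⟩), mem_periodicOrbit_next.2 ⟨0, rfl⟩⟩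
  -- Once the walk meets the axis, its next dart is a leg; by periodicity that leg leads back to
  -- `d`.
  have hback : ∃ m, ∃ i, G.next^[m] (G.leg i) = d := by
    simp only [AvoidsAxis, not_forall, not_not] at h
    obtain ⟨k, hk⟩ := h
    obtain ⟨i, hi⟩ := isBoundary_tail_iff.1 (isBoundary_tail_next.2 hk)
    rw [← Function.iterate_succ_apply' G.next] at hi
    obtain ⟨p, hp, hper⟩ := Function.mem_periodicPts.1 (mem_periodicPts_next d)
    -- The `k + 1` steps from `d` to the leg are completed to a multiple of the period `p`.
    refine ⟨(k + 1) * p - (k + 1), i, ?_⟩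
    rw [← hi, ← Function.iterate_add_apply,
      Nat.sub_add_cancel (Nat.le_mul_of_pos_right _ hp)]
    exact hper.const_mul (k + 1)
  have hmin : ∀ m' < Nat.find hback, ∀ i, G.next^[m'] (G.leg i) ≠ d := fun m' hm' i hi =>
    Nat.find_min hback hm' ⟨i, hi⟩
  obtain ⟨i, hi⟩ := Nat.find_spec hback
  set m := Nat.find hback
  -- Meeting the axis earlier would give a leg closer behind `d`, against the minimality of `m`.
  have hfree : ∀ j < m, ¬ IsBoundary (head (G.next^[j] (G.leg i))) := by
    intro j hj hb
    obtain ⟨i', hi'⟩ := isBoundary_tail_iff.1 (isBoundary_tail_next.2 hb)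
    rw [← Function.iterate_succ_apply' G.next] at hi'
    refine hmin (m - (j + 1)) (by omega) i' ?_
    rw [← hi', ← Function.iterate_add_apply, Nat.sub_add_cancel hj, hi]
  have hfwd : ∃ k, IsBoundary (head (G.next^[k] (G.leg i))) := by
    simp only [AvoidsAxis, not_forall, not_not] at h
    obtain ⟨k, hk⟩ := h
    exact ⟨k + m, by rwa [Function.iterate_add_apply, hi]⟩
  have hr : ReachesAxis i (Nat.find hfwd) := ⟨fun j hj => Nat.find_min hfwd hj, Nat.find_spec hfwd⟩
  refine ⟨_, mem_baseStranding.2 (.inr ⟨i, _, ?_, hr, rfl⟩), mem_arcWalk.2 ⟨m, ?_, hi⟩⟩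
  · rwa [← rightColor_iterate_next _ m, hi]
  · by_contra! hlt
    exact hfree _ hlt hr.2

theorem isProper_of_mem_baseStranding (hn : 2 ≤ n) {s : G.Strand} (hs : s ∈ G.baseStranding) :
    s.IsProper := by
  rcases mem_baseStranding.1 hs with ⟨d, h0, h, rfl⟩ | ⟨i, k, h0, h, rfl⟩
  -- The orbit has a single color, so a map injective on darts of equal color is injective on it;
  -- this serves for both vertices and edges.
  · have hinj : ∀ {β : Type} (g : G.Dart → β),
        (∀ x y : G.Dart, g x = g y → rightColor x = rightColor y → x = y) →
        ((Function.periodicOrbit G.next d).map g).Nodup := by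
      intro β g hg
      have hnodup : (Function.periodicOrbit G.next d).Nodup := Function.nodup_periodicOrbit
      rw [Function.periodicOrbit_def, Cycle.nodup_coe_iff] at hnodup
      rw [Function.periodicOrbit_def, Cycle.map_coe, Cycle.nodup_coe_iff]
      refine hnodup.map_on fun x hx y hy hxy => hg x y hxy ?_
      obtain ⟨j, _, rfl⟩ := List.mem_map.1 hx
      obtain ⟨j', _, rfl⟩ := List.mem_map.1 hy
      rw [rightColor_iterate_next, rightColor_iterate_next]
    refine ⟨⟨Nat.one_le_iff_ne_zero.2 h0, rightColor_lt hn d⟩, ?_, ?_, ?_, ?_⟩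
    · rw [Ne, Function.periodicOrbit_eq_nil_iff_not_periodic_pt, not_not]
      exact mem_periodicPts_next d
    · rw [Function.periodicOrbit_chain]
      intro j _
      rw [Function.iterate_succ_apply', tail_next (h j)]
    · exact hinj _ fun x y => eq_of_tail_eq_of_rightColor_eq hn
    · exact hinj _ fun x y => eq_of_fst_eq_of_rightColor_eq hn
  · have hcol : ∀ x ∈ arcWalk i k, rightColor x = rightColor (G.leg i) := fun x hx => by
      obtain ⟨j, _, rfl⟩ := mem_arcWalk.1 hx
      exact rightColor_iterate_next _ _
    obtain ⟨j, hj⟩ := h.2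
    have hnodup := h.arcWalk_nodup
    refine ⟨⟨Nat.one_le_iff_ne_zero.2 h0, rightColor_lt hn _⟩, ?_, i, j, ?_, ?_, ?_⟩
    · simp [arcWalk]
    · have := isWalk_iterate_next (G.leg i) k h.1
      rwa [tail_leg, hj] at this
    -- A dart of the arc ending at its starting point would be the reverse of the leg, whose two
    -- sides have different colors.
    · refine List.nodup_cons.2 ⟨fun hi => ?_, hnodup.map_on fun x hx y hy hxy =>
        eq_of_head_eq_of_rightColor_eq hn hxy ((hcol x hx).trans (hcol y hy).symm)⟩
      obtain ⟨x, hx, hxi⟩ := List.mem_map.1 hi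
      have hrev : rev x = G.leg i := (G.tail_eq_inl_iff _ _).1 hxi
      exact rightColor_rev_ne hn x (by rw [hrev, hcol x hx])
    · exact hnodup.map_on fun x hx y hy hxy =>
        eq_of_fst_eq_of_rightColor_eq hn hxy ((hcol x hx).trans (hcol y hy).symm)

/-- Away from the boundary, a strand leaves every vertex through which it passes. -/
theorem exists_uses_tail_eq {s : G.Strand} (hs : s ∈ G.baseStranding) {v : G.Vertex}
    (hb : ¬ IsBoundary v) (hv : v ∈ s.vertices) : ∃ d, s.Uses d ∧ tail d = v := by
  obtain ⟨d, hd, h | rfl⟩ := hv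
  · exact ⟨d, hd, h⟩
  refine ⟨G.next d, ?_, tail_next hb⟩
  rcases mem_baseStranding.1 hs with ⟨d₀, _, _, rfl⟩ | ⟨i, k, _, h, rfl⟩
  · obtain ⟨j, rfl⟩ := mem_periodicOrbit_next.1 hd
    exact mem_periodicOrbit_next.2 ⟨j + 1, Function.iterate_succ_apply' _ _ _⟩
  · obtain ⟨j, hj, rfl⟩ := mem_arcWalk.1 hd
    have hjk : j ≠ k := by
      rintro rfl
      exact hb h.2
    exact mem_arcWalk.2 ⟨j + 1, by omega, Function.iterate_succ_apply' _ _ _⟩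

/-- At an interior vertex both strands leave along darts of the same color, hence along the same
dart. At a boundary vertex both use its only edge, and the color fixes the direction. -/
theorem eq_of_mem_vertices (hn : 2 ≤ n) {s t : G.Strand} (hs : s ∈ G.baseStranding)
    (ht : t ∈ G.baseStranding) (hc : s.color = t.color) {v : G.Vertex}
    (hvs : v ∈ s.vertices) (hvt : v ∈ t.vertices) : s = t := by
  have hcol : ∀ {d d' : G.Dart}, s.Uses d → t.Uses d' → rightColor d = rightColor d' :=
    fun hd hd' => by rw [rightColor_eq_color hs hd, rightColor_eq_color ht hd', hc]
  by_cases hb : IsBoundary v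
  · obtain ⟨i, rfl⟩ := hb
    obtain ⟨d, hd, h⟩ := hvs
    obtain ⟨d', hd', h'⟩ := hvt
    have hfst : ∀ {x : G.Dart}, tail x = Sum.inl i ∨ head x = Sum.inl i → x.1 = (G.leg i).1 := by
      rintro x (hx | hx)
      · rw [(G.tail_eq_inl_iff x i).1 hx]
      · rw [← (G.tail_eq_inl_iff (rev x) i).1 hx, rev]
    obtain rfl := eq_of_fst_eq_of_rightColor_eq hn ((hfst h).trans (hfst h').symm) (hcol hd hd')
    exact eq_of_uses hs ht hd hd'
  · obtain ⟨d, hd, h⟩ := exists_uses_tail_eq hs hb hvs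
    obtain ⟨d', hd', h'⟩ := exists_uses_tail_eq ht hb hvt
    obtain rfl := eq_of_tail_eq_of_rightColor_eq hn (h.trans h'.symm) (hcol hd hd')
    exact eq_of_uses hs ht hd hd'

theorem isStranding_baseStranding (hn : 2 ≤ n) : IsStranding G.baseStranding :=
  ⟨fun _ hs => isProper_of_mem_baseStranding hn hs, fun _ hs _ ht hst hc =>
    Set.disjoint_left.2 fun _ hvs hvt => hst (eq_of_mem_vertices hn hs ht hc hvs hvt)⟩

/-! ### Validity -/

/-- This reduces validity on an edge to arithmetic with the two colors beside it. -/
theorem exists_color_uses_iff {c : ℕ} {d : G.Dart} :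
    (∃ s ∈ G.baseStranding, s.color = c ∧ s.Uses d) ↔ c ≠ 0 ∧ c = rightColor d := by
  constructor
  · rintro ⟨s, hs, rfl, hd⟩
    exact ⟨color_ne_zero hs, (rightColor_eq_color hs hd).symm⟩
  · rintro ⟨h, rfl⟩
    obtain ⟨s, hs, hd⟩ := exists_uses h
    exact ⟨s, hs, (rightColor_eq_color hs hd).symm, hd⟩

theorem mem_posColors_baseStranding {c : ℕ} {e : G.E} :
    c ∈ posColors G.baseStranding e ↔ c ≠ 0 ∧ c = rightColor ((e, true) : G.Dart) :=
  exists_color_uses_iff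

theorem mem_negColors_baseStranding {c : ℕ} {e : G.E} :
    c ∈ negColors G.baseStranding e ↔ c ≠ 0 ∧ c = rightColor ((e, false) : G.Dart) :=
  exists_color_uses_iff

/-- The factor `c` absorbs the exceptional color `0`, which has no strand. -/
theorem coroot_mul_baseStranding (hn : 2 ≤ n) (c : ℕ) (e : G.E) :
    coroot G.baseStranding c e * (c : ℤ) =
      (if c = rightColor ((e, true) : G.Dart) then (c : ℤ) else 0) -
        if c = rightColor ((e, false) : G.Dart) then (c : ℤ) else 0 := by
  have h := rightColor_true_ne_false hn e
  rw [coroot]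
  simp only [mem_posColors_baseStranding, mem_negColors_baseStranding]
  split_ifs <;> grind

theorem sum_coroot_mul_baseStranding (hn : 2 ≤ n) (e : G.E) :
    ∑ c ∈ Finset.Ico 1 n, coroot G.baseStranding c e * (c : ℤ) =
      (rightColor ((e, true) : G.Dart) : ℤ) - rightColor ((e, false) : G.Dart) := by
  have hsum : ∀ a < n, (∑ c ∈ Finset.Ico 1 n, if c = a then (c : ℤ) else 0) = a := by
    intro a ha
    rw [Finset.sum_ite_eq' (Finset.Ico 1 n) a fun c => (c : ℤ), ite_eq_left_iff, Finset.mem_Ico]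
    intro h
    -- The only value below `n` missing from the range of summation contributes nothing anyway.
    have : a = 0 := by omega
    simp [this]
  simp only [coroot_mul_baseStranding hn, Finset.sum_sub_distrib]
  rw [hsum _ (rightColor_lt hn _), hsum _ (rightColor_lt hn _)]

theorem isValidOn_baseStranding (hn : 2 ≤ n) (e : G.E) : IsValidOn G.baseStranding e := by
  have hne := rightColor_true_ne_false hn e
  have hmod := rightColor_modEq hn e
  have ha := rightColor_lt hn ((e, false) : G.Dart)
  have hb := rightColor_lt hn ((e, true) : G.Dart)
  have hw := G.weight_lt e
  have hsum := sum_coroot_mul_baseStranding hn e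
  have hpos := fun c => mem_posColors_baseStranding (c := c) (e := e)
  have hneg := fun c => mem_negColors_baseStranding (c := c) (e := e)
  refine ⟨?_, ?_⟩
  -- There is at most one color in each direction, so two different colors run oppositely.
  · intro c hc c' hc' hlt _
    simp only [colors, Set.mem_union] at hc hc'
    simp only [coroot, hpos, hneg] at hc hc' ⊢
    grind
  rw [hsum]
  generalize rightColor ((e, true) : G.Dart) = b at *
  generalize rightColor ((e, false) : G.Dart) = a at *
  -- Since `a + ℓ < 2 * n`, reduction modulo `n` subtracts `n` at most once.
  have hval : (a < b → b = a + G.weight e) ∧ (b < a → b + n = a + G.weight e) := by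
    rw [Nat.ModEq, Nat.mod_eq_of_lt hb] at hmod
    rcases lt_or_ge (a + G.weight e) n with h | h
    · rw [Nat.mod_eq_of_lt h] at hmod
      omega
    · rw [Nat.mod_eq_sub_mod h, Nat.mod_eq_of_lt (by omega)] at hmod
      omega
  -- As `a ≠ b`, the maximum is nonzero and so is the color of an actual strand.
  refine ⟨max a b, ⟨?_, ?_⟩, ?_, ?_⟩
  · simp only [colors, Set.mem_union, hpos, hneg]
    omega
  · intro c hc
    simp only [colors, Set.mem_union, hpos, hneg] at hc
    omega
  · rw [hpos]
    omega
  · rw [hneg]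
    omega

end Web

/-- In every web graph the modulo `n` distance between faces is independent of the dual path, and
the base stranding that it defines is a valid stranding. -/
theorem theorem5p3 (n : ℕ) (hn : 2 ≤ n) (G : Web n) :
    (∀ (A B : G.F) (P : List G.Dart), G.IsDualPath A P B → G.distAlong P = G.dist A B) ∧
    Web.IsValidStranding G.baseStranding :=
  ⟨fun _ _ _ h => Web.distAlong_eq_dist hn h,
    Web.isStranding_baseStranding hn, Web.isValidOn_baseStranding hn⟩
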